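/- Let $\mathrm H$ be a real Hilbert space, $\mathbb R_+=[0,\infty)$, and let $\Gamma_0(\mathrm H)$ be the set of proper, lower semicontinuous, convex functions $g:\mathrm H\to\mathbb R\cup\{+\infty\}$, with subdifferential $\partial g(y)=\{\xi : \langle \xi,z-y\rangle\le g(z)-g(y)\ \forall z\in\mathrm H\}$. For a Lipschitz continuous, strongly monotone map $B:\mathrm H\to\mathrm H$ and $g\in\Gamma_0(\mathrm H)$ put $\mathrm{prox}_{B,g}:=(B+\partial g)^{-1}$; this is a single-valued map on $\mathrm H$, and $y=\mathrm{prox}_{B,g}(x)$ is the unique solution of the variational inequality $$(\mathrm{VI}(B,g,x))\qquad \forall z\in\mathrm H,\quad \langle B(y),z-y\rangle+g(z)-g(y)\ge\langle x,z-y\rangle .$$ Let $A:\mathbb R_+\times\mathrm H\to\mathrm H$, let $f:\mathbb R_+\times\mathrm H\to\mathbb R\cup\{+\infty\}$ with $f(t,\cdot)\in\Gamma_0(\mathrm H)$ for all $t\ge0$, and let $x:\mathbb R_+\to\mathrm H$. Assume that $A$ is uniformly Lipschitz continuous and uniformly strongly monotone: there are $M\ge0$ and $\alpha>0$ with $\|A(t,x_2)-A(t,x_1)\|\le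 M\|x_2-x_1\|$ and $\langle A(t,x_2)-A(t,x_1),x_2-x_1\rangle\ge\alpha\|x_2-x_1\|^2$ for all $t\ge0$ and $x_1,x_2\in\mathrm H$. Let $$y(t):=\mathrm{prox}_{A(t,\cdot),f(t,\cdot)}(x(t)),\qquad t\ge0,$$ and $v_0:=x(0)-A(0,y(0))$, so that $v_0\in\partial f(0,\cdot)(y(0))$. Assume moreover: 1. $x$ is differentiable at $t=0$ (from the right), with derivative $x'(0)$. 2. $A$ is semi-differentiable at $y(0)$: for every $w\in\mathrm H$ the limit $$D_sA(y(0))(w):=\lim_{\tau\to0^+,\ w'\to w}\frac{A(\tau,y(0)+\tau w')-A(0,y(0))}{\tau}$$ exists in $\mathrm H$. 3. $f(t,y(0))\in\mathbb R$ for all $t\ge0$, and $f$ is twice epi-differentiable at $y(0)$ for $v_0$: the functions $$\Delta^2_\tau(w):=\frac{f(\tau,y(0)+\tau w)-f(\tau,y(0))-\tau\langle v_0,w\rangle}{\tau^2},\qquad \tau>0,$$ Mosco epi-converge as $\tau\to0^+$ to a function $d^2_ef(y(0)|v_0):\mathrm H\to[-\infty,+\infty]$. That is, with $\mathrm{Epi}(g)=\{(w,\lambda)\in\mathrm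 H\times\mathbb R: g(w)\le\lambda\}$ and $S_\tau=\mathrm{Epi}(\Delta^2_\tau)$, every weak limit of a sequence $p_n\in S_{t_n}$ with $0<t_n\to0$ belongs to the set $L$ of those $p\in\mathrm H\times\mathbb R$ such that for each sequence $0<t_n\to0$ there is a sequence $p_n\to p$ (strongly) with $p_n\in S_{t_n}$ for all large $n$; and $\mathrm{Epi}(d^2_ef(y(0)|v_0))=L$. 4. $d^2_ef(y(0)|v_0)\in\Gamma_0(\mathrm H)$. Then $y:\mathbb R_+\to\mathrm H$ is differentiable at $t=0$ (from the right) with $$y'(0)=\mathrm{prox}_{D_sA(y(0)),\,d^2_ef(y(0)|v_0)}(x'(0)).$$ Equivalently, $y'(0)$ exists and is the unique solution of $\mathrm{VI}\big(D_sA(y(0)),\,d^2_ef(y(0)|v_0),\,x'(0)\big)$. -/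

import Mathlib

open Filter Topology Set

namespace ParamVI

section Limits

variable {E : Type*} [NormedAddCommGroup E] [NormedSpace ℝ E]

/-- Weak convergence of a sequence. -/
def WeakTendsto (u : ℕ → E) (x : E) : Prop :=
  Tendsto (fun n => toWeakSpace ℝ E (u n)) atTop (𝓝 (toWeakSpace ℝ E x))

/-- The sequential weak-outer limit, as `τ → 0`, of a family of sets indexed by `τ > 0`. -/
def weakOuterLimit (S : ℝ → Set E) : Set E :=
  {x | ∃ t : ℕ → ℝ, (∀ n, 0 < t n) ∧ Tendsto t atTop (𝓝 0) ∧
    ∃ u : ℕ → E, WeakTendsto u x ∧ ∀ n, u n ∈ S (t n)}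

/-- The inner limit, as `τ → 0`, of a family of sets indexed by `τ > 0`. -/
def innerLimit (S : ℝ → Set E) : Set E :=
  {x | ∀ t : ℕ → ℝ, (∀ n, 0 < t n) → Tendsto t atTop (𝓝 0) →
    ∃ u : ℕ → E, Tendsto u atTop (𝓝 x) ∧ ∃ N : ℕ, ∀ n ≥ N, u n ∈ S (t n)}

/-- The family `S` (indexed by `τ > 0`) is Mosco convergent as `τ → 0`, and its limit is `L`. -/
def MoscoConvergesTo (S : ℝ → Set E) (L : Set E) : Prop :=
  weakOuterLimit S ⊆ innerLimit S ∧ L = innerLimit S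

end Limits

section Functions

variable {H : Type*} [NormedAddCommGroup H] [InnerProductSpace ℝ H]

/-- The epigraph of an extended-real-valued function, a subset of `H × ℝ`. -/
def epi (g : H → EReal) : Set (H × ℝ) := {p | g p.1 ≤ (p.2 : EReal)}

/-- The class `Γ₀(H)`: functions with values in `ℝ ∪ {+∞}` that are proper, lower
semicontinuous and convex. -/
structure IsGammaZero (g : H → EReal) : Prop where
  ne_bot : ∀ z, g z ≠ ⊥
  proper : ∃ z, g z ≠ ⊤
  lsc : IsClosed (epi g)
  convex : Convex ℝ (epi g)

/-- The family `F` (indexed by `τ > 0`) of extended-real-valued functions is Mosco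
epi-convergent as `τ → 0`, with limit `g`. -/
def EpiConvergesTo (F : ℝ → H → EReal) (g : H → EReal) : Prop :=
  MoscoConvergesTo (fun τ => epi (F τ)) (epi g)

/-- The subdifferential of convex analysis. -/
def subdiff (g : H → EReal) (x : H) : Set H :=
  {ξ | ∀ z, ((inner ℝ ξ (z - x) : ℝ) : EReal) ≤ g z - g x}

/-- The set-valued map `(B + ∂g)⁻¹`. -/
def proxSet (B : H → H) (g : H → EReal) (x : H) : Set H :=
  {y | ∃ ξ ∈ subdiff g y, x = B y + ξ}

/-- The generalized proximity operator `prox_{B,g} = (B + ∂g)⁻¹` as a single-valued map: the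
element of `proxSet B g x` (an arbitrary point should `proxSet B g x` be empty). -/
noncomputable def prox (B : H → H) (g : H → EReal) (x : H) : H :=
  Classical.epsilon fun y => y ∈ proxSet B g x

/-- `y` solves the nonlinear variational inequality of second kind `VI(B, g, x)`. -/
def SolvesVI (B : H → H) (g : H → EReal) (x y : H) : Prop :=
  ∀ z, ((inner ℝ x (z - y) : ℝ) : EReal) ≤ ((inner ℝ (B y) (z - y) : ℝ) : EReal) + g z - g y

/-- `A(t, ·)`, `t ≥ 0`, is Lipschitz continuous and strongly monotone, with constants that do not
depend on `t`. -/
def IsUnifLipStrongMono (A : ℝ → H → H) : Prop :=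
  (∃ M : ℝ, 0 ≤ M ∧ ∀ t, 0 ≤ t → ∀ x₁ x₂, ‖A t x₂ - A t x₁‖ ≤ M * ‖x₂ - x₁‖) ∧
  (∃ α : ℝ, 0 < α ∧ ∀ t, 0 ≤ t → ∀ x₁ x₂,
    α * ‖x₂ - x₁‖ ^ 2 ≤ inner ℝ (A t x₂ - A t x₁) (x₂ - x₁))

/-- The parameterized map `A` is semi-differentiable at `x` with semi-derivative `D`. -/
def HasSemiDerivAt (A : ℝ → H → H) (x : H) (D : H → H) : Prop :=
  ∀ w, Tendsto (fun p : ℝ × H => p.1⁻¹ • (A p.1 (x + p.1 • p.2) - A 0 x))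
    (𝓝[>] (0 : ℝ) ×ˢ 𝓝 w) (𝓝 (D w))

/-- The points at which every `f(t, ·)`, `t ≥ 0`, is finite. -/
def finitePoints (f : ℝ → H → EReal) : Set H :=
  {x | ∀ t, 0 ≤ t → f t x ≠ ⊥ ∧ f t x ≠ ⊤}

/-- The second-order difference quotient of the parameterized function `f` at `x` for `v`. -/
noncomputable def secondQuotient (f : ℝ → H → EReal) (x v : H) (τ : ℝ) (w : H) : EReal :=
  (f τ (x + τ • w) - f τ x - ((τ * inner ℝ v w : ℝ) : EReal)) / ((τ ^ 2 : ℝ) : EReal)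

/-- For `x` a point of finiteness of `f` and `v ∈ ∂f(0, ·)(x)`: the parameterized function `f` is
twice epi-differentiable at `x` for `v`, with second epi-derivative `g`. -/
def HasSecondEpiDerivAt (f : ℝ → H → EReal) (x v : H) (g : H → EReal) : Prop :=
  EpiConvergesTo (fun τ => secondQuotient f x v τ) g

end Functions

end ParamVI

open ParamVI

namespace ParamVI

/-! The quotient `w τ = (y τ - y 0) / τ` itself solves a variational inequality: its operator is the
difference quotient of `A`, its function the second-order quotient of `f`, its right-hand side the
difference quotient of `x`. These data converge to `DA`, `d2f` and `x'`, so the theorem reduces to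
stability of solutions, `EpiConvergesTo.tendsto_solution`.

Stability needs no a priori bound on `w`. If `w` stayed away from the limit solution `u`, take a
recovery sequence for `u` and, on each segment from it to `w`, the point at a fixed small distance
`η`. Convexity and strong monotonicity bound the function there by the linear term minus `α * η ^
2`. These points are bounded, and a weak cluster point violates the subgradient inequality at `u` by
`α * η ^ 2`. The operators are evaluated only along the recovery sequence, which converges strongly,
so semi-differentiability suffices.

Existence of both proximal points comes from `IsGammaZero.existsUnique_proxSet`: a forward-backward
step is a contraction. -/

variable {H : Type*} [NormedAddCommGroup H] [InnerProductSpace ℝ H]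

/-! ### Weak convergence -/

/-- A bounded sequence of a Hilbert space has a weakly convergent subsequence. -/
theorem exists_subseq_tendsto_inner [CompleteSpace H] {u : ℕ → H} {R : ℝ}
    (hu : ∀ n, ‖u n‖ ≤ R) :
    ∃ (p : H) (φ : ℕ → ℕ), StrictMono φ ∧
      ∀ v, Tendsto (fun n => inner ℝ v (u (φ n))) atTop (𝓝 (inner ℝ v p)) := by
  -- `H` may be non-separable; sequential Banach-Alaoglu is applied in the separable closed span of
  -- the sequence.
  set K : Submodule ℝ H := (Submodule.span ℝ (range u)).topologicalClosure with hK
  have hsep : TopologicalSpace.IsSeparable (K : Set H) := by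
    rw [hK, Submodule.topologicalClosure_coe]
    exact ((countable_range u).isSeparable.span (R := ℝ)).closure
  have : TopologicalSpace.SeparableSpace K := hsep.separableSpace
  have : CompleteSpace K :=
    (Submodule.isClosed_topologicalClosure _).isComplete.completeSpace_coe
  have hmem : ∀ n, u n ∈ K := fun n =>
    Submodule.le_topologicalClosure _ (Submodule.subset_span (mem_range_self n))
  let k : ℕ → K := fun n => ⟨u n, hmem n⟩
  obtain ⟨l, -, φ, hφ, hl⟩ := WeakDual.isSeqCompact_closedBall ℝ K 0 R
    (x := fun n => StrongDual.toWeakDual (InnerProductSpace.toDual ℝ K (k n)))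
    (fun n => by
      have : ‖InnerProductSpace.toDual ℝ K (k n)‖ ≤ R := by
        rw [LinearIsometryEquiv.norm_map]; exact hu n
      simpa using this)
  refine ⟨((InnerProductSpace.toDual ℝ K).symm (WeakDual.toStrongDual l) : K), φ, hφ, fun v => ?_⟩
  have key := ((WeakDual.eval_continuous (𝕜 := ℝ) (K.orthogonalProjectionOnto v)).tendsto l).comp hl
  have h1 : ∀ q : K, inner ℝ v (q : H) = inner ℝ q (K.orthogonalProjectionOnto v) := fun q => by
    rw [real_inner_comm]
    exact (Submodule.inner_orthogonalProjectionOnto_eq_of_mem_left q v).symm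
  simp only [h1]
  convert key using 1
  · funext n
    exact h1 (k (φ n))
  · rw [InnerProductSpace.toDual_symm_apply]; rfl

theorem weakTendsto_prodMk [CompleteSpace H] {u : ℕ → H} {p : H} {a : ℕ → ℝ} {b : ℝ}
    (hu : ∀ v, Tendsto (fun n => inner ℝ v (u n)) atTop (𝓝 (inner ℝ v p)))
    (ha : Tendsto a atTop (𝓝 b)) : WeakTendsto (fun n => (u n, a n)) (p, b) := by
  refine (WeakBilin.tendsto_iff_forall_eval_tendsto (B := (topDualPairing ℝ (H × ℝ)).flip)
    ?_).2 fun l => ?_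
  · refine (injective_iff_map_eq_zero _).2 fun q hq => ?_
    by_contra hne
    obtain ⟨l, hl⟩ := SeparatingDual.exists_ne_zero (R := ℝ) (V := H × ℝ) hne
    exact hl (LinearMap.congr_fun hq l)
  · let l₁ : StrongDual ℝ H := l.comp (ContinuousLinearMap.inl ℝ H ℝ)
    have hl : ∀ z c, l (z, c) = inner ℝ ((InnerProductSpace.toDual ℝ H).symm l₁) z + c * l (0, 1) :=
      fun z c => by
        rw [InnerProductSpace.toDual_symm_apply]
        have : ((z, c) : H × ℝ) = (z, 0) + c • (0, 1) := by simp
        rw [this, map_add, map_smul]; rfl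
    change Tendsto (fun n => l (u n, a n)) atTop (𝓝 (l (p, b)))
    rw [hl p b]
    exact ((hu _).add (ha.mul_const _)).congr fun n => (hl _ _).symm

/-! ### Subdifferentials and variational inequalities -/

/-- Trades `EReal` arithmetic for real inequalities on the epigraph. Finiteness at `y` is automatic:
`g y = ⊤` would make the right-hand side `⊥`. -/
theorem mem_subdiff_iff {g : H → EReal} (hb : ∀ z, g z ≠ ⊥) (hp : ∃ z, g z ≠ ⊤) {ξ y : H} :
    ξ ∈ subdiff g y ↔
      ∃ μ : ℝ, g y = μ ∧ ∀ z (c : ℝ), g z ≤ c → inner ℝ ξ (z - y) ≤ c - μ := by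
  constructor
  · intro h
    have hy : g y ≠ ⊤ := by
      intro hy
      obtain ⟨z, -⟩ := hp
      have := h z
      rw [hy, EReal.sub_top] at this
      exact absurd this (by simp)
    refine ⟨(g y).toReal, (EReal.coe_toReal hy (hb y)).symm, fun z c hz => ?_⟩
    have h1 := (h z).trans (EReal.sub_le_sub hz le_rfl)
    rw [← EReal.coe_toReal hy (hb y)] at h1
    exact_mod_cast h1
  · rintro ⟨μ, hμ, h⟩ z
    rw [hμ]
    by_cases hz : g z = ⊤
    · simp [hz]
    · rw [← EReal.coe_toReal hz (hb z)]
      exact_mod_cast h z _ (EReal.coe_toReal hz (hb z)).ge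

theorem mem_proxSet_iff {B : H → H} {g : H → EReal} {x y : H} :
    y ∈ proxSet B g x ↔ x - B y ∈ subdiff g y := by
  constructor
  · rintro ⟨ξ, hξ, rfl⟩
    simpa using hξ
  · exact fun h => ⟨_, h, by simp⟩

theorem solvesVI_iff {B : H → H} {g : H → EReal} {x y : H} :
    SolvesVI B g x y ↔ y ∈ proxSet B g x := by
  rw [mem_proxSet_iff]
  refine forall_congr' fun z => ?_
  rw [inner_sub_left, sub_eq_add_neg _ (g y), add_assoc, ← sub_eq_add_neg (g z)]
  generalize g z - g y = t
  induction t with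
  | bot => simp [-EReal.coe_sub]
  | top => simp [-EReal.coe_sub]
  | coe t => norm_cast; constructor <;> intro h <;> linarith

/-- Monotonicity of the subdifferential. -/
theorem inner_nonneg_of_mem_subdiff {g : H → EReal} (hb : ∀ z, g z ≠ ⊥) (hp : ∃ z, g z ≠ ⊤)
    {ξ₁ ξ₂ y₁ y₂ : H} (h₁ : ξ₁ ∈ subdiff g y₁) (h₂ : ξ₂ ∈ subdiff g y₂) :
    0 ≤ inner ℝ (ξ₁ - ξ₂) (y₁ - y₂) := by
  obtain ⟨m₁, e₁, h₁⟩ := (mem_subdiff_iff hb hp).1 h₁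
  obtain ⟨m₂, e₂, h₂⟩ := (mem_subdiff_iff hb hp).1 h₂
  have a := h₁ y₂ m₂ e₂.le
  have b := h₂ y₁ m₁ e₁.le
  rw [← neg_sub y₁ y₂, inner_neg_right] at a
  rw [inner_sub_left]
  linarith

/-! ### Existence and uniqueness of proximal points -/

/-- A lower semicontinuous convex function with a point of finiteness decreases at most linearly. -/
theorem IsGammaZero.exists_linear_lower_bound {g : H → EReal} (hg : IsGammaZero g) :
    ∃ (u : H) (a b : ℝ), 0 ≤ b ∧ ∀ p ∈ epi g, a - b * ‖p.1 - u‖ ≤ p.2 := by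
  obtain ⟨u, hu⟩ := hg.proper
  obtain ⟨m, hm⟩ : ∃ m : ℝ, g u = m := ⟨_, (EReal.coe_toReal hu (hg.ne_bot u)).symm⟩
  have hnot : (u, m - 1) ∈ (epi g)ᶜ := by
    simp only [epi, mem_compl_iff, mem_ofPred_eq, hm, not_le]
    exact_mod_cast sub_one_lt m
  obtain ⟨δ, hδ, hball⟩ := Metric.isOpen_iff.1 hg.lsc.isOpen_compl _ hnot
  have hlow : ∀ z : H, ‖z - u‖ < δ → ∀ c : ℝ, (z, c) ∈ epi g → m - 1 < c := by
    intro z hz c hc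
    by_contra hcm
    refine hball (a := (z, m - 1)) ?_ ?_
    · rw [Metric.mem_ball, Prod.dist_eq, dist_self, dist_eq_norm]
      exact max_lt hz hδ
    · exact le_trans (show g z ≤ c from hc) (by exact_mod_cast not_lt.1 hcm)
  refine ⟨u, m - 1, 2 / δ, by positivity, fun p hp => ?_⟩
  by_cases hz : ‖p.1 - u‖ < δ
  · have := hlow p.1 hz p.2 hp
    have : 0 ≤ 2 / δ * ‖p.1 - u‖ := by positivity
    linarith
  · push Not at hz
    set r := ‖p.1 - u‖ with hr
    have hr0 : 0 < r := hδ.trans_le hz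
    -- The weight `δ / (2 * r)` pulls `p` back to distance `δ / 2` from `u`, where the local bound
    -- `m - 1` holds.
    have hs1 : δ / (2 * r) ≤ 1 := by rw [div_le_one (by positivity)]; linarith
    have hmem := hg.convex (show (u, m) ∈ epi g from hm.le) hp
      (sub_nonneg.2 hs1) (by positivity : 0 ≤ δ / (2 * r)) (by ring)
    have hlt := hlow _ ?_ _ hmem
    · simp only [Prod.smul_snd, smul_eq_mul] at hlt
      have hx : δ / (2 * r) * (m - p.2) < 1 := by linarith
      rw [div_mul_eq_mul_div, div_lt_one (by positivity)] at hx
      have : m - p.2 < 2 / δ * r := by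
        rw [div_mul_eq_mul_div, lt_div_iff₀ hδ]; linarith
      linarith
    · have : ((1 - δ / (2 * r)) • (u, m) + (δ / (2 * r)) • p).1 - u
          = (δ / (2 * r)) • (p.1 - u) := by
        simp only [Prod.fst_add, Prod.smul_fst]; module
      rw [← Prod.fst_add, this, norm_smul, Real.norm_of_nonneg (by positivity), ← hr]
      field_simp
      linarith

/-- The Moreau envelope is attained. -/
theorem IsGammaZero.exists_isMinOn [CompleteSpace H] {g : H → EReal} (hg : IsGammaZero g)
    (v : H) {k : ℝ} (hk : 0 < k) :
    ∃ q ∈ epi g, ∀ p ∈ epi g, q.2 + k * ‖q.1 - v‖ ^ 2 ≤ p.2 + k * ‖p.1 - v‖ ^ 2 := by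
  let Φ : H × ℝ → ℝ := fun p => p.2 + k * ‖p.1 - v‖ ^ 2
  obtain ⟨u, a, b, hb, hlow⟩ := hg.exists_linear_lower_bound
  have hbdd : BddBelow (Φ '' epi g) := by
    refine ⟨a - b * ‖v - u‖ - b ^ 2 / (4 * k), ?_⟩
    rintro _ ⟨p, hp, rfl⟩
    have h1 := hlow p hp
    have h2 : ‖p.1 - u‖ ≤ ‖p.1 - v‖ + ‖v - u‖ := norm_sub_le_norm_sub_add_norm_sub ..
    have h3 := mul_le_mul_of_nonneg_left h2 hb
    have h4 : 0 ≤ b ^ 2 / (4 * k) - b * ‖p.1 - v‖ + k * ‖p.1 - v‖ ^ 2 := by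
      have : b ^ 2 / (4 * k) - b * ‖p.1 - v‖ + k * ‖p.1 - v‖ ^ 2
          = (b - 2 * k * ‖p.1 - v‖) ^ 2 / (4 * k) := by field_simp; ring
      rw [this]; positivity
    change _ ≤ p.2 + k * ‖p.1 - v‖ ^ 2
    linarith
  have hne : (Φ '' epi g).Nonempty := by
    obtain ⟨z, hz⟩ := hg.proper
    exact ⟨_, (z, (g z).toReal), EReal.le_coe_toReal hz, rfl⟩
  set m := sInf (Φ '' epi g) with hm
  have hmle : ∀ p ∈ epi g, m ≤ Φ p := fun p hp => csInf_le hbdd (mem_image_of_mem _ hp)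
  obtain ⟨s, -, hs, hsmem⟩ := exists_seq_tendsto_sInf hne hbdd
  choose w hw hws using hsmem
  have hΦw : Tendsto (fun n => Φ (w n)) atTop (𝓝 m) := by simpa only [hws] using hs
  -- Comparing with the midpoint through the parallelogram law makes every minimizing sequence
  -- Cauchy in its first component.
  have hmid : ∀ p ∈ epi g, ∀ q ∈ epi g,
      ‖p.1 - q.1‖ ^ 2 ≤ 2 / k * ((Φ p - m) + (Φ q - m)) := by
    intro p hp q hq
    have hpq := hmle _ (hg.convex hp hq (by norm_num : (0 : ℝ) ≤ 1 / 2)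
      (by norm_num : (0 : ℝ) ≤ 1 / 2) (by norm_num))
    have e1 : ((1 / 2 : ℝ) • p + (1 / 2 : ℝ) • q).1 - v
        = (1 / 2 : ℝ) • ((p.1 - v) + (q.1 - v)) := by
      simp only [Prod.fst_add, Prod.smul_fst]; module
    have e2 : ‖((1 / 2 : ℝ) • p + (1 / 2 : ℝ) • q).1 - v‖ ^ 2
        = (1 / 4) * ‖(p.1 - v) + (q.1 - v)‖ ^ 2 := by
      rw [e1, norm_smul, mul_pow]; norm_num
    have e3 := parallelogram_law_with_norm ℝ (p.1 - v) (q.1 - v)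
    rw [sub_sub_sub_cancel_right] at e3
    have e4 : Φ ((1 / 2 : ℝ) • p + (1 / 2 : ℝ) • q)
        = (p.2 + q.2) / 2 + k * ((1 / 4) * ‖(p.1 - v) + (q.1 - v)‖ ^ 2) := by
      change _ + k * _ = _
      rw [e2]; simp only [Prod.snd_add, Prod.smul_snd, smul_eq_mul]; ring
    rw [e4] at hpq
    have e5 : ‖p.1 - v + (q.1 - v)‖ ^ 2
        = 2 * (‖p.1 - v‖ ^ 2 + ‖q.1 - v‖ ^ 2) - ‖p.1 - q.1‖ ^ 2 := by linarith
    rw [e5] at hpq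
    rw [div_mul_eq_mul_div, le_div_iff₀ hk]
    change _ ≤ 2 * ((p.2 + k * ‖p.1 - v‖ ^ 2 - m) + (q.2 + k * ‖q.1 - v‖ ^ 2 - m))
    linarith
  have hcau : CauchySeq fun n => (w n).1 := by
    rw [Metric.cauchySeq_iff]
    intro ε hε
    have hev : ∀ᶠ n in atTop, Φ (w n) < m + k * ε ^ 2 / 4 :=
      hΦw.eventually_lt_const (by have : 0 < k * ε ^ 2 / 4 := by positivity
                                  linarith)
    obtain ⟨N, hN⟩ := eventually_atTop.1 hev
    refine ⟨N, fun i hi j hj => ?_⟩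
    have h := hmid _ (hw i) _ (hw j)
    have h' : 2 / k * ((Φ (w i) - m) + (Φ (w j) - m)) < ε ^ 2 := by
      rw [div_mul_eq_mul_div, div_lt_iff₀ hk]
      linarith [hN i hi, hN j hj]
    rw [dist_eq_norm]
    exact lt_of_pow_lt_pow_left₀ 2 hε.le (h.trans_lt h')
  obtain ⟨y, hy⟩ := cauchySeq_tendsto_of_complete hcau
  have h2 : Tendsto (fun n => (w n).2) atTop (𝓝 (m - k * ‖y - v‖ ^ 2)) := by
    have := hΦw.sub (((hy.sub_const v).norm.pow 2).const_mul k)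
    refine this.congr fun n => ?_
    change (w n).2 + k * ‖(w n).1 - v‖ ^ 2 - k * ‖(w n).1 - v‖ ^ 2 = _
    ring
  refine ⟨(y, m - k * ‖y - v‖ ^ 2),
    hg.lsc.mem_of_tendsto (hy.prodMk_nhds h2) (Eventually.of_forall hw), fun p hp => ?_⟩
  have := hmle p hp
  change m ≤ p.2 + k * ‖p.1 - v‖ ^ 2 at this
  simpa using this

/-- The resolvent of the subdifferential is everywhere defined. -/
theorem IsGammaZero.exists_smul_sub_mem_subdiff [CompleteSpace H] {g : H → EReal}
    (hg : IsGammaZero g) (v : H) {k : ℝ} (hk : 0 < k) : ∃ y, k • (v - y) ∈ subdiff g y := by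
  obtain ⟨⟨y, μ⟩, hq, hmin⟩ := hg.exists_isMinOn v (half_pos hk)
  have hgy : g y = μ := by
    refine le_antisymm hq ?_
    have hy : g y ≠ ⊤ := ((show g y ≤ μ from hq).trans_lt (EReal.coe_lt_top μ)).ne
    have := hmin (y, (g y).toReal) (EReal.le_coe_toReal hy)
    rw [← EReal.coe_toReal hy (hg.ne_bot y)]
    exact_mod_cast (add_le_add_iff_right _).1 this
  refine ⟨y, (mem_subdiff_iff hg.ne_bot hg.proper).2 ⟨μ, hgy, fun z c hz => ?_⟩⟩
  by_contra hlt
  push Not at hlt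
  rw [real_inner_smul_left] at hlt
  -- Minimality along the segment towards `z`, divided by `s`; letting `s → 0` removes the quadratic
  -- term.
  have hseg : ∀ s : ℝ, 0 < s → s ≤ 1 →
      k * inner ℝ (v - y) (z - y) - (c - μ) ≤ s * (k / 2 * ‖z - y‖ ^ 2) := by
    intro s hs hs1
    have h := hmin _ (hg.convex hq (show (z, c) ∈ epi g from hz) (sub_nonneg.2 hs1) hs.le (by ring))
    have e : ((1 - s) • (y, μ) + s • (z, c)).1 - v = s • (z - y) - (v - y) := by
      simp only [Prod.fst_add, Prod.smul_fst]; module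
    rw [e, norm_sub_sq_real (s • (z - y)), norm_smul, mul_pow, Real.norm_of_nonneg hs.le,
      real_inner_smul_left, real_inner_comm, norm_sub_rev v y] at h
    simp only [Prod.snd_add, Prod.smul_snd, smul_eq_mul] at h
    refine le_of_mul_le_mul_left ?_ hs
    linarith
  have hlim : Tendsto (fun s : ℝ => s * (k / 2 * ‖z - y‖ ^ 2)) (𝓝[>] 0) (𝓝 0) := by
    have : Continuous fun s : ℝ => s * (k / 2 * ‖z - y‖ ^ 2) := by fun_prop
    simpa using (this.tendsto 0).mono_left nhdsWithin_le_nhds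
  have := ge_of_tendsto hlim (by
    filter_upwards [Ioc_mem_nhdsGT (zero_lt_one (α := ℝ))] with s hs using hseg s hs.1 hs.2)
  linarith

/-- The generalized proximity operator of a Lipschitz strongly monotone map is single-valued. -/
theorem IsGammaZero.existsUnique_proxSet [CompleteSpace H] {g : H → EReal} (hg : IsGammaZero g)
    {B : H → H} {M α : ℝ} (hM : ∀ x₁ x₂, ‖B x₂ - B x₁‖ ≤ M * ‖x₂ - x₁‖) (hα : 0 < α)
    (hB : ∀ x₁ x₂, α * ‖x₂ - x₁‖ ^ 2 ≤ inner ℝ (B x₂ - B x₁) (x₂ - x₁)) (x : H) :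
    ∃! y, y ∈ proxSet B g x := by
  refine existsUnique_of_exists_of_unique ?_ fun y₁ y₂ h₁ h₂ => ?_
  -- This step size gives `ρ ^ 2 * M ^ 2 ≤ ρ * α`, so the squared Lipschitz constant `1 - 2 * ρ * α
  -- + ρ ^ 2 * M ^ 2` is at most `1 - ρ * α < 1`.
  · set ρ : ℝ := α / (M ^ 2 + α ^ 2) with hρ
    have hden : 0 < M ^ 2 + α ^ 2 := by positivity
    have hρ0 : 0 < ρ := by positivity
    have hρM : ρ * (M ^ 2 + α ^ 2) = α := div_mul_cancel₀ _ hden.ne'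
    choose J hJ using fun v => hg.exists_smul_sub_mem_subdiff v (inv_pos.2 hρ0)
    let T : H → H := fun v => J (v - ρ • (B v - x))
    have hJ1 : ∀ v₁ v₂, ‖J v₁ - J v₂‖ ≤ ‖v₁ - v₂‖ := by
      intro v₁ v₂
      have h := inner_nonneg_of_mem_subdiff hg.ne_bot hg.proper (hJ v₁) (hJ v₂)
      rw [← smul_sub, real_inner_smul_left] at h
      have h' := nonneg_of_mul_nonneg_right h (inv_pos.2 hρ0)
      have e : v₁ - J v₁ - (v₂ - J v₂) = (v₁ - v₂) - (J v₁ - J v₂) := by abel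
      rw [e, inner_sub_left, real_inner_self_eq_norm_sq] at h'
      have := real_inner_le_norm (v₁ - v₂) (J v₁ - J v₂)
      by_contra hlt
      push Not at hlt
      nlinarith [norm_nonneg (v₁ - v₂)]
    have hcontr : ∀ v₁ v₂, ‖T v₁ - T v₂‖ ≤ √(1 - ρ * α) * ‖v₁ - v₂‖ := by
      intro v₁ v₂
      refine (hJ1 _ _).trans ?_
      have e : v₁ - ρ • (B v₁ - x) - (v₂ - ρ • (B v₂ - x))
          = (v₁ - v₂) - ρ • (B v₁ - B v₂) := by module
      have hα1 : 0 ≤ 1 - ρ * α := by nlinarith [sq_nonneg M]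
      rw [e]
      refine abs_le_of_sq_le_sq' ?_ (by positivity) |>.2
      rw [mul_pow, Real.sq_sqrt hα1, norm_sub_sq_real, norm_smul, mul_pow,
        Real.norm_of_nonneg hρ0.le, real_inner_smul_right, real_inner_comm]
      have h1 := mul_le_mul_of_nonneg_left (hB v₂ v₁) hρ0.le
      have h2 : ‖B v₁ - B v₂‖ ^ 2 ≤ M ^ 2 * ‖v₁ - v₂‖ ^ 2 := by
        rw [← mul_pow]; exact pow_le_pow_left₀ (norm_nonneg _) (hM v₂ v₁) 2
      have h3 : ρ ^ 2 * M ^ 2 ≤ ρ * α := by nlinarith [mul_nonneg hρ0.le (mul_nonneg hρ0.le (sq_nonneg α))]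
      have h4 := mul_le_mul_of_nonneg_left h2 (sq_nonneg ρ)
      have h5 := mul_le_mul_of_nonneg_right h3 (sq_nonneg ‖v₁ - v₂‖)
      linarith
    have hT : ContractingWith (Real.toNNReal √(1 - ρ * α)) T := by
      refine ⟨?_, LipschitzWith.of_dist_le_mul fun v₁ v₂ => ?_⟩
      · rw [Real.toNNReal_lt_one, Real.sqrt_lt' one_pos]
        have : 0 < ρ * α := by positivity
        linarith
      · rw [dist_eq_norm, dist_eq_norm, Real.coe_toNNReal _ (Real.sqrt_nonneg _)]
        exact hcontr v₁ v₂
    have hfix : T hT.fixedPoint = hT.fixedPoint := hT.fixedPoint_isFixedPt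
    refine ⟨hT.fixedPoint, mem_proxSet_iff.2 ?_⟩
    set y := hT.fixedPoint
    have h := hJ (y - ρ • (B y - x))
    change ρ⁻¹ • (y - ρ • (B y - x) - T y) ∈ subdiff g (T y) at h
    rw [hfix] at h
    have e : ρ⁻¹ • (y - ρ • (B y - x) - y) = x - B y := by
      rw [sub_sub_cancel_left, ← smul_neg, inv_smul_smul₀ hρ0.ne', neg_sub]
    rwa [e] at h
  · have h := inner_nonneg_of_mem_subdiff hg.ne_bot hg.proper (mem_proxSet_iff.1 h₁)
      (mem_proxSet_iff.1 h₂)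
    rw [sub_sub_sub_cancel_left, ← neg_sub, inner_neg_left] at h
    have h' := hB y₂ y₁
    have h0 : ‖y₁ - y₂‖ ^ 2 ≤ 0 := by
      by_contra hlt
      push Not at hlt
      linarith [mul_pos hα hlt]
    exact sub_eq_zero.1 (norm_eq_zero.1 (pow_eq_zero_iff two_ne_zero |>.1
      (le_antisymm h0 (sq_nonneg _))))

theorem proxSet_eq_singleton {B : H → H} {g : H → EReal} {x : H}
    (h : ∃! y, y ∈ proxSet B g x) : proxSet B g x = {prox B g x} :=
  h.exists.elim fun y hy => subset_antisymm
    (fun _ hz => h.unique hz (Classical.epsilon_spec ⟨y, hy⟩))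
    (singleton_subset_iff.2 (Classical.epsilon_spec (p := fun y => y ∈ proxSet B g x) ⟨y, hy⟩))

/-! ### Stability under Mosco epi-convergence -/

/-- Stability of variational inequalities under Mosco epi-convergence: the solutions for `F τ`
converge strongly to the solution for the epi-limit. -/
theorem EpiConvergesTo.tendsto_solution [CompleteSpace H] {F : ℝ → H → EReal} {g : H → EReal}
    (hF : ∀ τ, 0 < τ → Convex ℝ (epi (F τ))) (hFg : EpiConvergesTo F g)
    (hb : ∀ z, g z ≠ ⊥) (hp : ∃ z, g z ≠ ⊤) {B : ℝ → H → H} {α : ℝ} (hα : 0 < α)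
    (hB : ∀ τ, 0 < τ → ∀ x₁ x₂, α * ‖x₂ - x₁‖ ^ 2 ≤ inner ℝ (B τ x₂ - B τ x₁) (x₂ - x₁))
    {u d c : H} {ξ : ℝ → H}
    (hBu : Tendsto (fun p : ℝ × H => B p.1 p.2) (𝓝[>] (0 : ℝ) ×ˢ 𝓝 u) (𝓝 d))
    (hξ : Tendsto ξ (𝓝[>] 0) (𝓝 c)) (hu : c - d ∈ subdiff g u) {w : ℝ → H}
    (hw : ∀ τ, 0 < τ → ∃ μ : ℝ, F τ (w τ) ≤ μ ∧
      ∀ z (l : ℝ), F τ z ≤ l → inner ℝ (ξ τ - B τ (w τ)) (z - w τ) ≤ l - μ) :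
    Tendsto w (𝓝[>] 0) (𝓝 u) := by
  obtain ⟨γ, hγ, hu⟩ := (mem_subdiff_iff hb hp).1 hu
  by_contra hnot
  rw [Metric.tendsto_nhds] at hnot
  push Not at hnot
  obtain ⟨ε, hε, hfreq⟩ := hnot
  obtain ⟨t, ht, htp⟩ := exists_seq_forall_of_frequently
    (hfreq.and_eventually (self_mem_nhdsWithin : ∀ᶠ τ : ℝ in 𝓝[>] 0, τ ∈ Ioi 0))
  have htpos : ∀ n, 0 < t n := fun n => (htp n).2
  have hu_inner : ((u, γ) : H × ℝ) ∈ innerLimit fun τ => epi (F τ) := by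
    rw [← hFg.2]; exact hγ.le
  obtain ⟨q, hq, N, hqN⟩ := hu_inner t htpos (ht.mono_right inf_le_left)
  -- Once the recovery point is within `η` of `u`, it is at least `η` away from `w`, so the segment
  -- between them reaches distance `η`.
  set η := ε / 2 with hη
  have hη0 : 0 < η := half_pos hε
  have hq1 : Tendsto (fun n => (q n).1) atTop (𝓝 u) := (continuous_fst.tendsto _).comp hq
  have hq2 : Tendsto (fun n => (q n).2) atTop (𝓝 γ) := (continuous_snd.tendsto _).comp hq
  obtain ⟨N', hN'⟩ := eventually_atTop.1 ((Metric.tendsto_nhds.1 hq1 η hη0).and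
    (eventually_ge_atTop N))
  have hshift : Tendsto (fun n => n + N') atTop atTop := tendsto_add_atTop_nat N'
  have hP : ∀ n, ∃ P ∈ epi (F (t (n + N'))), ‖P.1 - (q (n + N')).1‖ = η ∧
      P.2 ≤ (q (n + N')).2 - inner ℝ (ξ (t (n + N')) - B (t (n + N')) (q (n + N')).1)
        ((q (n + N')).1 - P.1) - α * η ^ 2 := by
    intro n
    obtain ⟨hdist, hge⟩ := hN' (n + N') (Nat.le_add_left _ _)
    have hwdist := (htp (n + N')).1
    have hτ := htpos (n + N')
    have hQ := hqN _ hge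
    generalize q (n + N') = Q at *
    generalize t (n + N') = τ at *
    obtain ⟨μ, hμ, hsol⟩ := hw τ hτ
    set r := ‖w τ - Q.1‖ with hr
    have hrη : η ≤ r := by
      have := dist_triangle (w τ) Q.1 u
      rw [dist_eq_norm (w τ) Q.1] at this
      linarith
    have hr0 : 0 < r := hη0.trans_le hrη
    set s := η / r with hs
    have hs0 : 0 ≤ s := by positivity
    have hs1 : s ≤ 1 := (div_le_one hr0).2 hrη
    have hsr : s * r = η := div_mul_cancel₀ _ hr0.ne'
    refine ⟨(1 - s) • Q + s • (w τ, μ), hF τ hτ hQ hμ (sub_nonneg.2 hs1) hs0 (by ring), ?_, ?_⟩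
    · have : ((1 - s) • Q + s • (w τ, μ)).1 - Q.1 = s • (w τ - Q.1) := by
        simp only [Prod.fst_add, Prod.smul_fst]; module
      rw [this, norm_smul, Real.norm_of_nonneg hs0, ← hr, hsr]
    · have e : Q.1 - ((1 - s) • Q + s • (w τ, μ)).1 = s • (Q.1 - w τ) := by
        simp only [Prod.fst_add, Prod.smul_fst]; module
      rw [e, real_inner_smul_right]
      simp only [Prod.snd_add, Prod.smul_snd, smul_eq_mul]
      have h1 := hsol Q.1 Q.2 hQ
      have h2 := hB τ hτ (w τ) Q.1
      rw [norm_sub_rev, ← hr] at h2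
      have h3 : inner ℝ (ξ τ - B τ (w τ)) (Q.1 - w τ)
          = inner ℝ (ξ τ - B τ Q.1) (Q.1 - w τ)
            + inner ℝ (B τ Q.1 - B τ (w τ)) (Q.1 - w τ) := by
        rw [← inner_add_left]; congr 1; abel
      have h4 : inner ℝ (ξ τ - B τ Q.1) (Q.1 - w τ) + α * r ^ 2 ≤ Q.2 - μ := by linarith
      have h5 := mul_le_mul_of_nonneg_left h4 hs0
      -- Here `s * r ^ 2 = η * r` and `r ≥ η`.
      have h6 : α * η ^ 2 ≤ s * (α * r ^ 2) := by
        have : s * (α * r ^ 2) = α * (η * r) := by rw [← hsr]; ring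
        rw [this, sq]
        gcongr
      linarith
  choose P hPmem hPnorm hPle using hP
  have hPbd : ∀ n, ‖(P n).1‖ ≤ η + η + ‖u‖ := by
    intro n
    have h1 := (hN' (n + N') (Nat.le_add_left _ _)).1.le
    rw [dist_eq_norm] at h1
    have h2 := norm_sub_le_norm_sub_add_norm_sub (P n).1 (q (n + N')).1 u
    have h3 := norm_le_norm_sub_add (P n).1 u
    linarith [hPnorm n]
  obtain ⟨p, φ, hφ, hweak⟩ := exists_subseq_tendsto_inner hPbd
  let ψ : ℕ → ℕ := fun n => φ n + N'
  have hψ : Tendsto ψ atTop atTop := hshift.comp hφ.tendsto_atTop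
  let b : ℕ → H := fun n => ξ (t (ψ n)) - B (t (ψ n)) (q (ψ n)).1
  have hbt : Tendsto b atTop (𝓝 (c - d)) :=
    (hξ.comp (ht.comp hψ)).sub (hBu.comp ((ht.comp hψ).prodMk (hq1.comp hψ)))
  -- `b` converges strongly, so its pairing with a weakly convergent sequence passes to the limit.
  have hcross : Tendsto (fun n => inner ℝ (b n) ((q (ψ n)).1 - (P (φ n)).1)) atTop
      (𝓝 (inner ℝ (c - d) (u - p))) := by
    have hsmall : Tendsto (fun n => inner ℝ (b n - (c - d)) ((q (ψ n)).1 - (P (φ n)).1)) atTop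
        (𝓝 0) := by
      refine squeeze_zero_norm (a := fun n => ‖b n - (c - d)‖ * η) (fun n => ?_) ?_
      · refine (norm_inner_le_norm _ _).trans_eq ?_
        rw [norm_sub_rev (q (ψ n)).1, hPnorm]
      · simpa using ((hbt.sub_const (c - d)).norm).mul_const η
    have hmain := (((continuous_const (y := c - d)).inner continuous_id).tendsto u
      |>.comp (hq1.comp hψ)).sub (hweak (c - d))
    have := hsmall.add hmain
    rw [zero_add, id, ← inner_sub_right] at this
    refine this.congr fun n => ?_
    simp only [Function.comp, id]
    rw [← inner_sub_right, ← inner_add_left, sub_add_cancel]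
  set l := γ - inner ℝ (c - d) (u - p) - α * η ^ 2 with hl
  have hlt : Tendsto (fun n => (q (ψ n)).2 - inner ℝ (b n) ((q (ψ n)).1 - (P (φ n)).1)
      - α * η ^ 2) atTop (𝓝 l) := ((hq2.comp hψ).sub hcross).sub_const _
  -- The heights of `P` need not converge; they are raised to their upper bounds, which do, and the
  -- raised points stay in the epigraphs.
  have hmem : (p, l) ∈ epi g := by
    rw [hFg.2]
    refine hFg.1 ⟨fun n => t (ψ n), fun n => htpos _, (ht.mono_right inf_le_left).comp hψ, _,
      weakTendsto_prodMk hweak hlt, fun n => ?_⟩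
    exact (show F _ (P (φ n)).1 ≤ _ from hPmem (φ n)).trans (by exact_mod_cast hPle (φ n))
  have hfin := hu p l hmem
  rw [hl, ← neg_sub u p, inner_neg_right] at hfin
  have : 0 < α * η ^ 2 := by positivity
  linarith

/-! ### Difference quotients of `f` and `A` -/

theorem secondQuotient_le_coe_iff {f : ℝ → H → EReal} {x v w : H} {τ a c : ℝ} (hτ : 0 < τ)
    (ha : f τ x = a) :
    secondQuotient f x v τ w ≤ c ↔
      f τ (x + τ • w) ≤ ((a + τ * inner ℝ v w + τ ^ 2 * c : ℝ) : EReal) := by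
  have h2 : 0 < τ ^ 2 := by positivity
  rw [secondQuotient, ha]
  generalize f τ (x + τ • w) = s
  induction s with
  | bot => simp [EReal.bot_div_of_pos_ne_top (EReal.coe_pos.2 h2) (EReal.coe_ne_top _), -EReal.coe_pow]
  | top =>
    rw [EReal.top_sub_coe, EReal.top_sub_coe,
      EReal.top_div_of_pos_ne_top (EReal.coe_pos.2 h2) (EReal.coe_ne_top _), top_le_iff, top_le_iff]
    simp only [EReal.coe_ne_top]
  | coe s =>
    rw [← EReal.coe_sub, ← EReal.coe_sub, ← EReal.coe_div, EReal.coe_le_coe_iff,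
      EReal.coe_le_coe_iff, div_le_iff₀ h2]
    constructor <;> intro h <;> linarith

theorem convex_epi_secondQuotient {f : ℝ → H → EReal} {x v : H} {τ a : ℝ} (hτ : 0 < τ)
    (ha : f τ x = a) (hf : Convex ℝ (epi (f τ))) : Convex ℝ (epi (secondQuotient f x v τ)) := by
  intro p hp q hq s r hs hr hsr
  have hp' := (secondQuotient_le_coe_iff hτ ha).1 hp
  have hq' := (secondQuotient_le_coe_iff hτ ha).1 hq
  refine (secondQuotient_le_coe_iff hτ ha).2 ?_
  have h := hf (x := (_, _)) hp' (y := (_, _)) hq' hs hr hsr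
  have e1 : x + τ • (s • p + r • q).1 = s • (x + τ • p.1) + r • (x + τ • q.1) := by
    simp only [Prod.fst_add, Prod.smul_fst]
    -- Only the first `x` is split as `(s + r) • x`.
    nth_rw 1 [← one_smul ℝ x, ← hsr]
    module
  rw [e1]
  refine le_trans (show f τ _ ≤ _ from h) (le_of_eq ?_)
  congr 1
  simp only [Prod.snd_add, Prod.smul_snd, Prod.fst_add, Prod.smul_fst, smul_eq_mul,
    inner_add_right, real_inner_smul_right]
  linear_combination a * hsr

/-- Difference quotients of a strongly monotone map are strongly monotone. -/
theorem strongMono_diffQuotient {B : H → H} {x b : H} {α τ : ℝ} (hτ : 0 < τ)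
    (hB : ∀ x₁ x₂, α * ‖x₂ - x₁‖ ^ 2 ≤ inner ℝ (B x₂ - B x₁) (x₂ - x₁)) (w₁ w₂ : H) :
    α * ‖w₂ - w₁‖ ^ 2 ≤
      inner ℝ (τ⁻¹ • (B (x + τ • w₂) - b) - τ⁻¹ • (B (x + τ • w₁) - b)) (w₂ - w₁) := by
  have h := hB (x + τ • w₁) (x + τ • w₂)
  rw [add_sub_add_left_eq_sub, ← smul_sub, norm_smul, Real.norm_of_nonneg hτ.le,
    real_inner_smul_right] at h
  rw [← smul_sub, sub_sub_sub_cancel_right, real_inner_smul_left, le_inv_mul_iff₀ hτ]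
  refine le_of_mul_le_mul_left ?_ hτ
  linarith

/-- The semi-derivative inherits the Lipschitz and monotonicity constants. -/
theorem HasSemiDerivAt.lipschitz_strongMono {A : ℝ → H → H} {x : H} {D : H → H}
    (hD : HasSemiDerivAt A x D) {M α : ℝ}
    (hM : ∀ t, 0 ≤ t → ∀ x₁ x₂, ‖A t x₂ - A t x₁‖ ≤ M * ‖x₂ - x₁‖)
    (hA : ∀ t, 0 ≤ t → ∀ x₁ x₂, α * ‖x₂ - x₁‖ ^ 2 ≤ inner ℝ (A t x₂ - A t x₁) (x₂ - x₁)) :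
    (∀ w₁ w₂, ‖D w₂ - D w₁‖ ≤ M * ‖w₂ - w₁‖) ∧
      ∀ w₁ w₂, α * ‖w₂ - w₁‖ ^ 2 ≤ inner ℝ (D w₂ - D w₁) (w₂ - w₁) := by
  have hlim : ∀ w, Tendsto (fun τ : ℝ => τ⁻¹ • (A τ (x + τ • w) - A 0 x)) (𝓝[>] 0) (𝓝 (D w)) :=
    fun w => (hD w).comp (tendsto_id.prodMk tendsto_const_nhds)
  refine ⟨fun w₁ w₂ => le_of_tendsto ((hlim w₂).sub (hlim w₁)).norm ?_, fun w₁ w₂ =>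
    ge_of_tendsto (((hlim w₂).sub (hlim w₁)).inner tendsto_const_nhds) ?_⟩
  · filter_upwards [self_mem_nhdsWithin] with τ (hτ : 0 < τ)
    have h := hM τ hτ.le (x + τ • w₁) (x + τ • w₂)
    rw [add_sub_add_left_eq_sub, ← smul_sub, norm_smul, Real.norm_of_nonneg hτ.le] at h
    rw [← smul_sub, sub_sub_sub_cancel_right, norm_smul, Real.norm_of_nonneg (inv_nonneg.2 hτ.le), inv_mul_le_iff₀ hτ]
    linarith
  · filter_upwards [self_mem_nhdsWithin] with τ (hτ : 0 < τ)
    exact strongMono_diffQuotient hτ (hA τ hτ.le) w₁ w₂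

end ParamVI

/-! ### Differentiability of the solution -/

theorem mainTheorem1 {H : Type*} [NormedAddCommGroup H] [InnerProductSpace ℝ H] [CompleteSpace H]
    (A : ℝ → H → H) (f : ℝ → H → EReal) (x y : ℝ → H) (x' : H)
    (DA : H → H) (d2f : H → EReal)
    (hA : IsUnifLipStrongMono A)
    (hf : ∀ t, 0 ≤ t → IsGammaZero (f t))
    (hy : ∀ t, 0 ≤ t → y t = prox (A t) (f t) (x t))
    (hx : HasDerivWithinAt x x' (Set.Ici 0) 0)
    (hDA : HasSemiDerivAt A (y 0) DA)
    (hfin : y 0 ∈ finitePoints f)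
    (hd2f : HasSecondEpiDerivAt f (y 0) (x 0 - A 0 (y 0)) d2f)
    (hd2f_gamma : IsGammaZero d2f) :
    -- the proximity operators are well defined, and `y t` is the unique solution of the VI
    (∀ t, 0 ≤ t → proxSet (A t) (f t) (x t) = {y t} ∧
      ∀ z, SolvesVI (A t) (f t) (x t) z ↔ z = y t) ∧
    x 0 - A 0 (y 0) ∈ subdiff (f 0) (y 0) ∧
    proxSet DA d2f x' = {prox DA d2f x'} ∧
    -- `y` is differentiable at `0` with the announced derivative
    HasDerivWithinAt y (prox DA d2f x') (Set.Ici 0) 0 ∧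
    -- the derivative is the unique solution of the derived variational inequality
    (∀ z, SolvesVI DA d2f x' z ↔ z = prox DA d2f x') := by
  obtain ⟨⟨M, -, hM⟩, α, hα, hmono⟩ := hA
  have hprox : ∀ t, 0 ≤ t → proxSet (A t) (f t) (x t) = {y t} := fun t ht => by
    rw [hy t ht]
    exact proxSet_eq_singleton
      ((hf t ht).existsUnique_proxSet (hM t ht) hα (hmono t ht) (x t))
  have hsub : ∀ t, 0 ≤ t → x t - A t (y t) ∈ subdiff (f t) (y t) := fun t ht =>
    mem_proxSet_iff.1 (by rw [hprox t ht]; rfl)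
  obtain ⟨hDM, hDmono⟩ := hDA.lipschitz_strongMono hM hmono
  have hD : proxSet DA d2f x' = {prox DA d2f x'} :=
    proxSet_eq_singleton (hd2f_gamma.existsUnique_proxSet hDM hα hDmono x')
  refine ⟨fun t ht => ⟨hprox t ht, fun z => by rw [solvesVI_iff, hprox t ht, mem_singleton_iff]⟩,
    hsub 0 le_rfl, hD, ?_, fun z => by rw [solvesVI_iff, hD, mem_singleton_iff]⟩
  have hfa : ∀ t, 0 ≤ t → f t (y 0) = ((f t (y 0)).toReal : EReal) := fun t ht =>
    (EReal.coe_toReal (hfin t ht).2 (hfin t ht).1).symm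
  rw [hasDerivWithinAt_iff_tendsto_slope, Ici_sdiff_left]
  rw [hasDerivWithinAt_iff_tendsto_slope, Ici_sdiff_left] at hx
  refine EpiConvergesTo.tendsto_solution (B := fun τ w => τ⁻¹ • (A τ (y 0 + τ • w) - A 0 (y 0)))
    (fun τ hτ => convex_epi_secondQuotient hτ (hfa τ hτ.le) (hf τ hτ.le).convex) hd2f
    hd2f_gamma.ne_bot hd2f_gamma.proper hα
    (fun τ hτ => strongMono_diffQuotient hτ (hmono τ hτ.le)) (hDA _) hx
    (mem_proxSet_iff.1 (by rw [hD]; rfl)) fun τ hτ => ?_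
  obtain ⟨m, hm, hVI⟩ := (mem_subdiff_iff (hf τ hτ.le).ne_bot (hf τ hτ.le).proper).1
    (hsub τ hτ.le)
  set v := x 0 - A 0 (y 0) with hv
  set w := slope y 0 τ with hw
  set a := (f τ (y 0)).toReal with ha
  have hyw : y 0 + τ • w = y τ := by
    rw [hw, slope_def_module, sub_zero, smul_inv_smul₀ hτ.ne', add_sub_cancel]
  have hτ2 : 0 < τ ^ 2 := by positivity
  -- The witness is the value of the second-order quotient at `w`, since `y 0 + τ • w = y τ` and `f
  -- τ (y τ) = m`.
  refine ⟨(m - a - τ * inner ℝ v w) / τ ^ 2, ?_, fun z l hz => ?_⟩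
  · rw [secondQuotient_le_coe_iff hτ (hfa τ hτ.le), hyw, hm, mul_div_cancel₀ _ hτ2.ne']
    exact_mod_cast (by linarith : m ≤ a + τ * inner ℝ v w + (m - a - τ * inner ℝ v w))
  -- The inequality solved by `y τ`, tested at `y 0 + τ • z` and divided by `τ ^ 2`; the term in `v`
  -- is absorbed by the quotients of `A` and `x`.
  · have h := hVI _ _ ((secondQuotient_le_coe_iff hτ (hfa τ hτ.le)).1 hz)
    have e : y 0 + τ • z - y τ = τ • (z - w) := by rw [← hyw]; module
    have e' : slope x 0 τ - τ⁻¹ • (A τ (y 0 + τ • w) - A 0 (y 0))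
        = τ⁻¹ • (x τ - A τ (y τ) - v) := by
      rw [hyw, slope_def_module, sub_zero, hv]; module
    rw [e, real_inner_smul_right] at h
    rw [e', real_inner_smul_left, inner_sub_left, le_sub_iff_add_le, ← le_sub_iff_add_le',
      div_le_iff₀ hτ2]
    have e3 : (l - τ⁻¹ * (inner ℝ (x τ - A τ (y τ)) (z - w) - inner ℝ v (z - w))) * τ ^ 2
        = l * τ ^ 2 - τ * (inner ℝ (x τ - A τ (y τ)) (z - w) - inner ℝ v (z - w)) := by
      field_simp
    rw [e3, inner_sub_right v]
    linarith
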